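/- Let $n$ and $r$ be positive integers with $r \mid n$, let $[k]=\{1,\dots,k\}$, and let $\mathbb{S}_n$ be the set of permutations of $[n]$, with identity $e$. For $\sigma\in\mathbb{S}_n$ let $\mathbf{m}_\sigma^r=(\mathbf{m}_\sigma^r(1),\dots,\mathbf{m}_\sigma^r(n))$ be the $r$-regular multipermutation given, for $i\in[n]$ and $j\in[n/r]$, by $\mathbf{m}_\sigma^r(i)=j$ if and only if $(j-1)r+1\le\sigma(i)\le jr$, and let $R_r(\sigma)=\{\pi\in\mathbb{S}_n : \mathbf{m}_\pi^r=\mathbf{m}_\sigma^r\}$. The Ulam distance between $\sigma,\pi\in\mathbb{S}_n$ is $\mathrm{d}_\circ(\sigma,\pi)=n-\ell(\sigma,\pi)$, where $\ell(\sigma,\pi)$ is the length of a longest common subsequence of $(\sigma(1),\dots,\sigma(n))$ and $(\pi(1),\dots,\pi(n))$. The $r$-regular Ulam distance is $$\mathrm{d}_\circ^r(\sigma,\pi)=\min_{\sigma'\in R_r(\sigma),\ \pi'\in R_r(\pi)}\mathrm{d}_\circ(\sigma',\pi'),$$ and the $r$-regular Ulam sphere of radius $t$ centered at $\mathbf{m}_\sigma^r$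 is $$S(\mathbf{m}_\sigma^r,t)=\{\mathbf{m}_\pi^r : \pi\in\mathbb{S}_n,\ \mathrm{d}_\circ^r(\sigma,\pi)\le t\}.$$ A Young tableau on a partition $\lambda\vdash n$ is a filling of the Young diagram of $\lambda$ with weakly increasing rows and strictly increasing columns. Let $f^\lambda$ be the number of standard Young tableaux on $\lambda$ (each of $1,\dots,n$ appears exactly once), let $K^\lambda_r$ be the number of Young tableaux on $\lambda$ in which each $i\in[n/r]$ appears exactly $r$ times, and let $\lambda_1$ denote the largest part of $\lambda$. Then for every integer $t$ with $0\le t\le n-1$, $$|S(\mathbf{m}_e^r,t)|=\sum_{\lambda\vdash n,\ \lambda_1\ge n-t} f^\lambda K^\lambda_r .$$ -/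

import Mathlib

namespace UlamSphere

/-- The sequence `(σ(1), …, σ(n))` with values in `{1, …, n}` (positions are indexed by `Fin n`). -/
def permSeq {n : ℕ} (σ : Equiv.Perm (Fin n)) : Fin n → ℕ :=
  fun i => (σ i : ℕ) + 1

/-- The `r`-regular multipermutation of `σ`; its values lie in `{1, …, n / r}`. -/
def multiperm {n : ℕ} (r : ℕ) (σ : Equiv.Perm (Fin n)) : Fin n → ℕ :=
  fun i => (σ i : ℕ) / r + 1

/-- `multiperm r σ i = j` if and only if `(j - 1) r + 1 ≤ σ(i) ≤ j r`. -/
theorem multiperm_eq_iff {n r : ℕ} (hr : 0 < r) (σ : Equiv.Perm (Fin n)) (i : Fin n)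
    (j : ℕ) (hj : 1 ≤ j) :
    multiperm r σ i = j ↔ (j - 1) * r + 1 ≤ permSeq σ i ∧ permSeq σ i ≤ j * r := by
  obtain ⟨j, rfl⟩ : ∃ k, j = k + 1 := ⟨j - 1, by omega⟩
  simp only [multiperm, permSeq, Nat.add_right_cancel_iff, Nat.add_sub_cancel]
  rw [Nat.div_eq_iff hr, add_mul]
  omega

/-- The length of a longest common subsequence of `u` and `v`. -/
noncomputable def lcsLength {n : ℕ} (u v : Fin n → ℕ) : ℕ :=
  sSup {k : ℕ | ∃ i j : Fin k → Fin n, StrictMono i ∧ StrictMono j ∧ ∀ p, u (i p) = v (j p)}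

/-- The supremum in `lcsLength` is a maximum. -/
theorem lcsLength_isGreatest {n : ℕ} (u v : Fin n → ℕ) :
    IsGreatest {k : ℕ | ∃ i j : Fin k → Fin n,
      StrictMono i ∧ StrictMono j ∧ ∀ p, u (i p) = v (j p)} (lcsLength u v) := by
  have hb : BddAbove {k : ℕ | ∃ i j : Fin k → Fin n,
      StrictMono i ∧ StrictMono j ∧ ∀ p, u (i p) = v (j p)} := by
    refine ⟨n, ?_⟩
    rintro k ⟨i, -, hi, -, -⟩
    simpa using Fintype.card_le_of_injective i hi.injective
  refine ⟨Nat.sSup_mem ⟨0, Fin.elim0, Fin.elim0, ?_, ?_, ?_⟩ hb, fun k hk => le_csSup hb hk⟩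
  · exact fun a => a.elim0
  · exact fun a => a.elim0
  · exact fun a => a.elim0

/-- The Ulam distance between permutations. -/
noncomputable def ulamDist {n : ℕ} (σ π : Equiv.Perm (Fin n)) : ℕ :=
  n - lcsLength (permSeq σ) (permSeq π)

/-- The equivalence class of `σ`: all permutations with the same `r`-regular multipermutation. -/
def eqvClass {n : ℕ} (r : ℕ) (σ : Equiv.Perm (Fin n)) : Set (Equiv.Perm (Fin n)) :=
  {π | multiperm r π = multiperm r σ}

/-- The `r`-regular Ulam distance: the minimum of the Ulam distance over the two equivalence
classes (which are nonempty). -/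
noncomputable def regUlamDist {n : ℕ} (r : ℕ) (σ π : Equiv.Perm (Fin n)) : ℕ :=
  sInf {d : ℕ | ∃ σ' ∈ eqvClass r σ, ∃ π' ∈ eqvClass r π, d = ulamDist σ' π'}

/-- The `r`-regular Ulam sphere of radius `t` centered at `multiperm r σ`, a set of
`r`-regular multipermutations. -/
def ulamSphere {n : ℕ} (r : ℕ) (σ : Equiv.Perm (Fin n)) (t : ℕ) : Set (Fin n → ℕ) :=
  {m | ∃ π : Equiv.Perm (Fin n), m = multiperm r π ∧ regUlamDist r σ π ≤ t}

/-- The Young diagram of a partition: its row lengths are the parts in decreasing order. -/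
def diagram {n : ℕ} (lam : n.Partition) : YoungDiagram :=
  YoungDiagram.ofRowLens (lam.parts.sort (· ≥ ·)) (Multiset.pairwise_sort _ _).sortedGE

/-- The number of cells of the tableau `T` that contain `j`. -/
def entryCount {μ : YoungDiagram} (T : SemistandardYoungTableau μ) (j : ℕ) : ℕ :=
  (μ.cells.filter fun c => T c.1 c.2 = j).card

/-- The number `f^λ` of standard Young tableaux: tableaux on `λ ⊢ n` in which each of
`1, …, n` appears exactly once. -/
noncomputable def numSYT {n : ℕ} (lam : n.Partition) : ℕ :=
  Nat.card {T : SemistandardYoungTableau (diagram lam) //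
    ∀ j ∈ Finset.Icc 1 n, entryCount T j = 1}

/-- The number `K^λ_r` of Young tableaux on `λ ⊢ n` in which each of `1, …, n / r` appears
exactly `r` times. -/
noncomputable def numRegTableaux {n : ℕ} (r : ℕ) (lam : n.Partition) : ℕ :=
  Nat.card {T : SemistandardYoungTableau (diagram lam) //
    ∀ j ∈ Finset.Icc 1 (n / r), entryCount T j = r}

end UlamSphere

namespace UlamSphere

/-! A multipermutation lies in the sphere around the identity exactly when it has a weakly
increasing subsequence of length at least n - t. A common subsequence of two representatives
projects to one. Conversely, standardization turns a weakly increasing subsequence into a strictly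
increasing one, which is common with the identity (`mem_ulamSphere_one_iff`). RSK sends such words
to pairs of tableaux of one shape λ, one with content (r, …, r) and one standard, where λ₁ is the
length of a longest weakly increasing subsequence. Counting by shape gives the sum.

RSK is realized by Fomin growth diagrams instead of insertion: a local rule attaches a shape to each
corner of the grid of a matrix. The rule is reversible, so matrices correspond to pairs of chains
along the outer boundary (`growth_injective`, `exists_growth_eq`). Row and column sums of the matrix
become strip sizes (`sum_growth`), and the first row of a shape obeys the recursion for longest
weakly increasing subsequences (`le_growth_wordMatrix_iff`). Finally, chains of horizontal strips
are tableaux (`card_tableaux_eq_ncard_chains`). -/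

/-! ### Growth diagrams: the local rule and its inverse -/

/-- `s` is obtained from `t` by removing a horizontal strip (shapes are given by row lengths). -/
def Interlaces (s t : ℕ → ℕ) : Prop := ∀ k, s k ≤ t k ∧ t (k + 1) ≤ s k

/-- The shapes of the growth diagram of the matrix `A`. -/
def growth (A : ℕ → ℕ → ℕ) : ℕ → ℕ → ℕ → ℕ
  | 0, _, _ => 0
  | _ + 1, 0, _ => 0
  | i + 1, j + 1, 0 => max (growth A i (j + 1) 0) (growth A (i + 1) j 0) + A i j
  | i + 1, j + 1, k + 1 =>
      max (growth A i (j + 1) (k + 1)) (growth A (i + 1) j (k + 1)) +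
        min (growth A i (j + 1) k) (growth A (i + 1) j k) - growth A i j k
termination_by i j => (i, j)

/-- The shapes of a growth diagram reconstructed from its outer boundary `p`, `q`; the indices
count the distance to that boundary. -/
def shrink (p q : ℕ → ℕ → ℕ) : ℕ → ℕ → ℕ → ℕ
  | 0, j, k => p j k
  | i + 1, 0, k => q (i + 1) k
  | i + 1, j + 1, k =>
      max (shrink p q (i + 1) j (k + 1)) (shrink p q i (j + 1) (k + 1)) +
        min (shrink p q (i + 1) j k) (shrink p q i (j + 1) k) - shrink p q i j (k + 1)
termination_by i j => (i, j)

theorem growth_zero_left (A : ℕ → ℕ → ℕ) (j : ℕ) : growth A 0 j = 0 := by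
  funext k; simp [growth]

theorem growth_zero_right (A : ℕ → ℕ → ℕ) (i : ℕ) : growth A i 0 = 0 := by
  funext k; cases i <;> simp [growth]

theorem growth_succ_zero (A : ℕ → ℕ → ℕ) (i j : ℕ) : growth A (i + 1) (j + 1) 0 =
    max (growth A i (j + 1) 0) (growth A (i + 1) j 0) + A i j := by
  rw [growth]

theorem growth_succ_succ (A : ℕ → ℕ → ℕ) (i j k : ℕ) : growth A (i + 1) (j + 1) (k + 1) =
    max (growth A i (j + 1) (k + 1)) (growth A (i + 1) j (k + 1)) +
        min (growth A i (j + 1) k) (growth A (i + 1) j k) - growth A i j k := by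
  rw [growth]

theorem shrink_zero_left (p q : ℕ → ℕ → ℕ) (j : ℕ) : shrink p q 0 j = p j := by
  funext k; rw [shrink]

theorem shrink_zero_right {p q : ℕ → ℕ → ℕ} (h : p 0 = q 0) (i : ℕ) :
    shrink p q i 0 = q i := by
  funext k
  cases i with
  | zero => rw [shrink, h]
  | succ i => rw [shrink]

theorem shrink_succ (p q : ℕ → ℕ → ℕ) (i j k : ℕ) : shrink p q (i + 1) (j + 1) k =
      max (shrink p q (i + 1) j (k + 1)) (shrink p q i (j + 1) (k + 1)) +
        min (shrink p q (i + 1) j k) (shrink p q i (j + 1) k) - shrink p q i j (k + 1) := by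
  rw [shrink]

theorem interlaces_zero : Interlaces 0 0 := fun _ => by simp

/-- For an inner shape ρ with neighbours μ, ν, interlacing says max(μ_{k+1}, ν_{k+1}) ≤ ρ_k ≤
min(μ_k, ν_k). Hence row k + 1 of the new shape lies between this max and this min, which is
interlacing with both neighbours. -/
theorem growth_interlaces (A : ℕ → ℕ → ℕ) (i : ℕ) : ∀ j,
    Interlaces (growth A i j) (growth A (i + 1) j) ∧
      Interlaces (growth A i j) (growth A i (j + 1)) := by
  induction i with
  | zero =>
    have key : ∀ j, Interlaces (0 : ℕ → ℕ) (growth A (0 + 1) j) := by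
      intro j
      induction j with
      | zero => rw [growth_zero_right]; exact interlaces_zero
      | succ j ih =>
        intro k
        refine ⟨by simp, ?_⟩
        have := (ih k).2
        rw [growth_succ_succ]
        simp only [growth_zero_left, Pi.zero_apply] at *
        omega
    intro j
    simp only [growth_zero_left]
    exact ⟨key j, interlaces_zero⟩
  | succ i ih =>
    have sq : ∀ j, Interlaces (growth A (i + 1) j) (growth A (i + 1) (j + 1)) ∧
        Interlaces (growth A i (j + 1)) (growth A (i + 1) (j + 1)) := fun j => by
      refine ⟨fun k => ⟨?_, ?_⟩, (ih (j + 1)).1⟩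
      · cases k with
        | zero => rw [growth_succ_zero]; omega
        | succ k =>
          have h1 := ((ih j).1 k)
          have h2 := ((ih j).2 k)
          rw [growth_succ_succ]; omega
      · have h1 := ((ih j).1 k)
        have h2 := ((ih j).2 k)
        rw [growth_succ_succ]; omega
    intro j
    refine ⟨?_, (sq j).1⟩
    induction j with
    | zero => simp only [growth_zero_right]; exact interlaces_zero
    | succ j ihj =>
      intro k
      constructor
      · cases k with
        | zero => rw [growth_succ_zero A (i + 1)]; omega
        | succ k =>
          have h1 := (sq j).1 k
          have h2 := ihj k
          rw [growth_succ_succ A (i + 1)]; omega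
      · have h1 := (sq j).1 k
        have h2 := ihj k
        rw [growth_succ_succ A (i + 1)]; omega

/-- Interlacing makes the truncated subtraction exact, so the rule can be solved for either corner.
-/
theorem growth_add (A : ℕ → ℕ → ℕ) (i j k : ℕ) :
    growth A (i + 1) (j + 1) (k + 1) + growth A i j k =
      max (growth A i (j + 1) (k + 1)) (growth A (i + 1) j (k + 1)) +
        min (growth A i (j + 1) k) (growth A (i + 1) j k) := by
  have h1 := (growth_interlaces A i j).1 k
  have h2 := (growth_interlaces A i j).2 k
  rw [growth_succ_succ]; omega

theorem shrink_interlaces {p q : ℕ → ℕ → ℕ} (h : p 0 = q 0)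
    (hp : ∀ j, Interlaces (p (j + 1)) (p j)) (hq : ∀ j, Interlaces (q (j + 1)) (q j))
    (i : ℕ) : ∀ j, Interlaces (shrink p q (i + 1) j) (shrink p q i j) ∧
      Interlaces (shrink p q i (j + 1)) (shrink p q i j) := by
  have step : ∀ i j, Interlaces (shrink p q (i + 1) j) (shrink p q i j) →
      Interlaces (shrink p q i (j + 1)) (shrink p q i j) →
      Interlaces (shrink p q (i + 1) (j + 1)) (shrink p q i (j + 1)) ∧
      Interlaces (shrink p q (i + 1) (j + 1)) (shrink p q (i + 1) j) := by
    intro i j h1 h2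
    refine ⟨fun k => ?_, fun k => ?_⟩ <;>
    · have a1 := h1 k
      have a2 := h2 k
      have a3 := h1 (k + 1)
      have a4 := h2 (k + 1)
      rw [shrink_succ]; omega
  induction i with
  | zero =>
    have c2 : ∀ j, Interlaces (shrink p q 0 (j + 1)) (shrink p q 0 j) := fun j => by
      simpa only [shrink_zero_left] using hp j
    intro j
    refine ⟨?_, c2 j⟩
    induction j with
    | zero => simpa only [shrink_zero_right h] using hq 0
    | succ j ihj => exact (step 0 j ihj (c2 j)).1
  | succ i ih =>
    have c2 : ∀ j, Interlaces (shrink p q (i + 1) (j + 1)) (shrink p q (i + 1) j) := fun j =>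
      (step i j (ih j).1 (ih j).2).2
    intro j
    refine ⟨?_, c2 j⟩
    induction j with
    | zero => simpa only [shrink_zero_right h] using hq (i + 1)
    | succ j ihj => exact (step (i + 1) j ihj (c2 j)).1

/-- Solving `growth_add` for the inner corner gives the rule of `shrink`; indices are reversed so
that the recursion starts at the outer boundary. -/
theorem growth_eq_shrink (A : ℕ → ℕ → ℕ) (n m : ℕ) : ∀ i ≤ n, ∀ j ≤ m,
    growth A (n - i) (m - j) =
      shrink (fun j => growth A n (m - j)) (fun i => growth A (n - i) m) i j := by
  intro i
  induction i with
  | zero => intro _ j _; rw [shrink_zero_left]; rfl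
  | succ i ih =>
    intro hi j
    induction j with
    | zero => intro _; rw [shrink_zero_right (by simp)]; rfl
    | succ j ihj =>
      intro hj
      funext k
      rw [shrink_succ, ← ihj (by omega), ← ih (by omega) _ hj, ← ih (by omega) j (by omega)]
      obtain ⟨a, ha⟩ : ∃ a, n - i = a + 1 := ⟨n - i - 1, by omega⟩
      obtain ⟨b, hb⟩ : ∃ b, m - j = b + 1 := ⟨m - j - 1, by omega⟩
      rw [show n - (i + 1) = a by omega, show m - (j + 1) = b by omega, ha, hb]
      have := growth_add A a b k
      have h1 := (growth_interlaces A a b).1 k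
      have h2 := (growth_interlaces A a b).2 k
      omega

/-- A growth diagram is determined by its outer boundary. -/
theorem growth_injective {A B : ℕ → ℕ → ℕ} {n m : ℕ}
    (hP : ∀ j ≤ m, growth A n j = growth B n j) (hQ : ∀ i ≤ n, growth A i m = growth B i m)
    {i j : ℕ} (hi : i < n) (hj : j < m) : A i j = B i j := by
  have key : ∀ i ≤ n, ∀ j ≤ m, growth A i j = growth B i j := by
    intro i hi j hj
    have h1 := growth_eq_shrink A n m (n - i) (by omega) (m - j) (by omega)
    have h2 := growth_eq_shrink B n m (n - i) (by omega) (m - j) (by omega)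
    rw [show n - (n - i) = i by omega, show m - (m - j) = j by omega] at h1 h2
    rw [h1, h2]
    congr 1
    · funext j; exact hP _ (by omega)
    · funext i; exact hQ _ (by omega)
  -- Equal shapes force equal entries, because the rule for row 0 is the one place where the entry
  -- occurs.
  have h := growth_succ_zero A i j
  rw [key _ (by omega) _ (by omega), key _ (by omega) _ (by omega),
    key _ (by omega) _ (by omega), growth_succ_zero B] at h
  omega

/-- Every outer boundary is the boundary of a growth diagram. -/
theorem exists_growth_eq {P Q : ℕ → ℕ → ℕ} {n m : ℕ} (h : P m = Q n) (hP0 : P 0 = 0)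
    (hQ0 : Q 0 = 0) (hP : ∀ j, Interlaces (P j) (P (j + 1)))
    (hQ : ∀ i, Interlaces (Q i) (Q (i + 1))) :
    ∃ A : ℕ → ℕ → ℕ, (∀ j ≤ m, growth A n j = P j) ∧ ∀ i ≤ n, growth A i m = Q i := by
  set p : ℕ → ℕ → ℕ := fun j => P (m - j) with hp
  set q : ℕ → ℕ → ℕ := fun i => Q (n - i) with hq
  have hpq : p 0 = q 0 := by simpa [hp, hq] using h
  have hi : ∀ (m : ℕ) (P : ℕ → ℕ → ℕ), P 0 = 0 → (∀ j, Interlaces (P j) (P (j + 1))) →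
      ∀ j, Interlaces (P (m - (j + 1))) (P (m - j)) := by
    intro m P hP0 hP j
    by_cases hj : j < m
    · rw [show m - j = m - (j + 1) + 1 by omega]; exact hP _
    · rw [show m - (j + 1) = 0 by omega, show m - j = 0 by omega, hP0]
      exact interlaces_zero
  have hint := shrink_interlaces hpq (hi m P hP0 hP) (hi n Q hQ0 hQ)
  -- On the sides opposite to the given boundary each shape is contained in the preceding one and
  -- the first is empty, so all are empty, as in a growth diagram.
  have hn0 : ∀ j, shrink p q n j = 0 := by
    intro j
    induction j with
    | zero => rw [shrink_zero_right hpq]; simpa [hq] using hQ0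
    | succ j ih =>
      funext k
      have := ((hint n j).2 k).1
      rw [ih] at this
      simpa using this
  have hm0 : ∀ i, shrink p q i m = 0 := by
    intro i
    induction i with
    | zero => rw [shrink_zero_left]; simpa [hp] using hP0
    | succ i ih =>
      funext k
      have := ((hint i m).1 k).1
      rw [ih] at this
      simpa using this
  -- The entry forced by the rule for row 0; interlacing makes the subtraction exact.
  let A : ℕ → ℕ → ℕ := fun i j => shrink p q (n - (i + 1)) (m - (j + 1)) 0 -
    max (shrink p q (n - i) (m - (j + 1)) 0) (shrink p q (n - (i + 1)) (m - j) 0)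
  have key : ∀ i ≤ n, ∀ j ≤ m, growth A i j = shrink p q (n - i) (m - j) := by
    intro i
    induction i with
    | zero => intro _ j _; rw [growth_zero_left, Nat.sub_zero, hn0]
    | succ i ih =>
      intro hi j
      induction j with
      | zero => intro _; rw [growth_zero_right, Nat.sub_zero, hm0]
      | succ j ihj =>
        intro hj
        obtain ⟨a, ha⟩ : ∃ a, n - i = a + 1 := ⟨n - i - 1, by omega⟩
        obtain ⟨b, hb⟩ : ∃ b, m - j = b + 1 := ⟨m - j - 1, by omega⟩
        have ha' : n - (i + 1) = a := by omega
        have hb' : m - (j + 1) = b := by omega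
        funext k
        cases k with
        | zero =>
          rw [growth_succ_zero, ihj (by omega), ih (by omega) _ hj]
          simp only [A, ha, hb, ha', hb']
          have h1 := (hint a b).1 0
          have h2 := (hint a b).2 0
          omega
        | succ k =>
          rw [growth_succ_succ, ihj (by omega), ih (by omega) _ hj, ih (by omega) j (by omega)]
          simp only [ha, hb, ha', hb']
          have h1 := (hint a b).1 k
          have h2 := (hint a b).2 k
          have h3 := (hint a b).1 (k + 1)
          have h4 := (hint a b).2 (k + 1)
          rw [shrink_succ]
          omega
  refine ⟨A, fun j hj => ?_, fun i hi => ?_⟩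
  · rw [key n le_rfl j hj, Nat.sub_self, shrink_zero_left]
    simp only [hp, show m - (m - j) = j by omega]
  · rw [key i hi m le_rfl, Nat.sub_self, shrink_zero_right hpq]
    simp only [hq, show n - (n - i) = i by omega]

/-! ### Sizes of the shapes -/

theorem growth_eq_zero (A : ℕ → ℕ → ℕ) (i j k : ℕ) (h : i ≤ k) : growth A i j k = 0 := by
  induction i generalizing k with
  | zero => rw [growth_zero_left]; rfl
  | succ i ih =>
    obtain ⟨k, rfl⟩ : ∃ l, k = l + 1 := ⟨k - 1, by omega⟩
    have := ((growth_interlaces A i j).1 k).2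
    rw [ih k (by omega)] at this
    omega

/-- Sum `growth_add` over the rows: the maxima of rows k + 1 and the minima of rows k appear, and
row 0 supplies the missing maximum together with `A i j`. Then max + min is the sum of the two
neighbours. The bound `i < N` ensures that no nonzero row is cut off. -/
theorem sum_growth (A : ℕ → ℕ → ℕ) {N i : ℕ} (j : ℕ) (hi : i < N) :
    ∑ k ∈ Finset.range N, growth A (i + 1) (j + 1) k + ∑ k ∈ Finset.range N, growth A i j k =
      ∑ k ∈ Finset.range N, growth A i (j + 1) k +
        ∑ k ∈ Finset.range N, growth A (i + 1) j k + A i j := by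
  have e1 : ∑ k ∈ Finset.range N, growth A (i + 1) (j + 1) k =
      ∑ k ∈ Finset.range N, growth A (i + 1) (j + 1) (k + 1) + growth A (i + 1) (j + 1) 0 := by
    rw [← Finset.sum_range_succ', Finset.sum_range_succ, growth_eq_zero A _ _ N hi, add_zero]
  have e2 : ∑ k ∈ Finset.range N, max (growth A i (j + 1) k) (growth A (i + 1) j k) =
      ∑ k ∈ Finset.range N, max (growth A i (j + 1) (k + 1)) (growth A (i + 1) j (k + 1)) +
        max (growth A i (j + 1) 0) (growth A (i + 1) j 0) := by
    rw [← Finset.sum_range_succ' (fun k => max (growth A i (j + 1) k) (growth A (i + 1) j k)),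
      Finset.sum_range_succ, growth_eq_zero A _ _ N hi, growth_eq_zero A _ _ N hi.le]
    simp
  have e3 : ∑ k ∈ Finset.range N, growth A (i + 1) (j + 1) (k + 1) +
      ∑ k ∈ Finset.range N, growth A i j k =
      ∑ k ∈ Finset.range N, max (growth A i (j + 1) (k + 1)) (growth A (i + 1) j (k + 1)) +
      ∑ k ∈ Finset.range N, min (growth A i (j + 1) k) (growth A (i + 1) j k) := by
    rw [← Finset.sum_add_distrib, ← Finset.sum_add_distrib]
    exact Finset.sum_congr rfl fun k _ => growth_add A i j k
  have e4 : ∑ k ∈ Finset.range N, max (growth A i (j + 1) k) (growth A (i + 1) j k) +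
      ∑ k ∈ Finset.range N, min (growth A i (j + 1) k) (growth A (i + 1) j k) =
      ∑ k ∈ Finset.range N, growth A i (j + 1) k +
        ∑ k ∈ Finset.range N, growth A (i + 1) j k := by
    rw [← Finset.sum_add_distrib, ← Finset.sum_add_distrib]
    exact Finset.sum_congr rfl fun k _ => max_add_min _ _
  have e5 := growth_succ_zero A i j
  omega

theorem sum_growth_succ_left (A : ℕ → ℕ → ℕ) {N i : ℕ} (m : ℕ) (hi : i < N) :
    ∑ k ∈ Finset.range N, growth A (i + 1) m k =
      ∑ k ∈ Finset.range N, growth A i m k + ∑ j ∈ Finset.range m, A i j := by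
  induction m with
  | zero => simp [growth_zero_right]
  | succ m ih =>
    have := sum_growth A m hi
    rw [Finset.sum_range_succ (fun j => A i j)]
    omega

theorem sum_growth_succ_right (A : ℕ → ℕ → ℕ) {N n : ℕ} (j : ℕ) (hn : n ≤ N) :
    ∑ k ∈ Finset.range N, growth A n (j + 1) k =
      ∑ k ∈ Finset.range N, growth A n j k + ∑ i ∈ Finset.range n, A i j := by
  induction n with
  | zero => simp [growth_zero_left]
  | succ n ih =>
    have := sum_growth A (i := n) j hn
    have := ih (by omega)
    rw [Finset.sum_range_succ (fun i => A i j)]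
    omega

/-! ### Regular words and weakly increasing subsequences -/

/-- The prescribed fibres already exhaust `s`, leaving no room for other values. -/
theorem mem_Icc_of_card_fibers {α : Type*} {s : Finset α} {f : α → ℕ} {m r : ℕ}
    (h : ∀ j ∈ Finset.Icc 1 m, (s.filter fun x => f x = j).card = r) (hs : m * r = s.card)
    {x : α} (hx : x ∈ s) : f x ∈ Finset.Icc 1 m := by
  have h1 := Finset.sum_card_fiberwise_eq_card_filter s (Finset.Icc 1 m) f
  rw [Finset.sum_congr rfl h, Finset.sum_const, Nat.card_Icc, smul_eq_mul, Nat.add_sub_cancel,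
    hs] at h1
  exact Finset.card_filter_eq_iff.mp h1.symm x hx

/-- Each of `1, …, m` appears exactly `r` times in the word `w`. -/
def IsRegularWord {n : ℕ} (m r : ℕ) (w : Fin n → ℕ) : Prop :=
  ∀ j ∈ Finset.Icc 1 m, (Finset.univ.filter fun i => w i = j).card = r

theorem IsRegularWord.mem_Icc {n m r : ℕ} {w : Fin n → ℕ} (h : IsRegularWord m r w)
    (hn : m * r = n) (i : Fin n) : w i ∈ Finset.Icc 1 m :=
  mem_Icc_of_card_fibers h (by simpa using hn) (Finset.mem_univ i)

theorem finite_isRegularWord {n m r : ℕ} (hn : m * r = n) :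
    {w : Fin n → ℕ | IsRegularWord m r w}.Finite :=
  (Set.Finite.pi' fun _ => (Finset.Icc 1 m).finite_toSet).subset fun _ hw i => hw.mem_Icc hn i

/-- The `0`-`1` matrix of a word with positive letters. -/
def wordMatrix {n : ℕ} (w : Fin n → ℕ) (i j : ℕ) : ℕ :=
  if h : i < n then if w ⟨i, h⟩ = j + 1 then 1 else 0 else 0

theorem wordMatrix_val {n : ℕ} (w : Fin n → ℕ) (i : Fin n) (j : ℕ) :
    wordMatrix w i j = if w i = j + 1 then 1 else 0 := by
  simp [wordMatrix]

theorem sum_wordMatrix_row {n m : ℕ} {w : Fin n → ℕ} (i : Fin n)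
    (hw : w i ∈ Finset.Icc 1 m) : ∑ j ∈ Finset.range m, wordMatrix w i j = 1 := by
  rw [Finset.mem_Icc] at hw
  rw [Finset.sum_eq_single_of_mem (w i - 1) (Finset.mem_range.mpr (by omega)), wordMatrix_val,
    if_pos (by omega)]
  intro j _ hj
  rw [wordMatrix_val, if_neg (by omega)]

theorem sum_wordMatrix_col {n : ℕ} (w : Fin n → ℕ) (j : ℕ) :
    ∑ i ∈ Finset.range n, wordMatrix w i j =
      (Finset.univ.filter fun i => w i = j + 1).card := by
  rw [Finset.sum_range, Finset.card_filter]
  exact Finset.sum_congr rfl fun i _ => wordMatrix_val w i j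

/-- The first row of the growth diagram measures the longest weakly increasing subsequences. -/
theorem le_growth_wordMatrix_iff {n : ℕ} {w : Fin n → ℕ} (hw : ∀ i, 1 ≤ w i) (a : ℕ) (ha : a ≤ n)
    (b k : ℕ) : k ≤ growth (wordMatrix w) a b 0 ↔
      ∃ S : Finset (Fin n), k ≤ S.card ∧ MonotoneOn w S ∧ ∀ x ∈ S, (x : ℕ) < a ∧ w x ≤ b := by
  induction a generalizing b k with
  | zero =>
    rw [growth_zero_left]
    constructor
    · intro h
      exact ⟨∅, by simpa using h, by simp [MonotoneOn], by simp⟩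
    · rintro ⟨S, hk, -, hS⟩
      have : S = ∅ := Finset.eq_empty_of_forall_notMem fun x hx => by have := hS x hx; omega
      simpa [this] using hk
  | succ a iha =>
    induction b generalizing k with
    | zero =>
      rw [growth_zero_right]
      constructor
      · intro h
        exact ⟨∅, by simpa using h, by simp [MonotoneOn], by simp⟩
      · rintro ⟨S, hk, -, hS⟩
        have : S = ∅ := Finset.eq_empty_of_forall_notMem fun x hx => by
          have := hS x hx
          have := hw x
          omega
        simpa [this] using hk
    | succ b ihb =>
      have iha := iha (by omega)
      rw [growth_succ_zero]
      set x₀ : Fin n := ⟨a, ha⟩ with hx₀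
      have hA : wordMatrix w a b = if w x₀ = b + 1 then 1 else 0 := wordMatrix_val w x₀ b
      constructor
      · intro h
        by_cases hc : w x₀ = b + 1
        · rw [if_pos hc] at hA
          obtain ⟨S, hk, hm, hS⟩ : ∃ S : Finset (Fin n), k - 1 ≤ S.card ∧ MonotoneOn w S ∧
              ∀ x ∈ S, (x : ℕ) < a ∧ w x ≤ b + 1 := by
            -- A set with letters at most b omits `x₀`, whose letter is b + 1. So in both cases only
            -- positions before a are used, and `x₀` can be appended.
            rcases le_total (growth (wordMatrix w) a (b + 1) 0)
              (growth (wordMatrix w) (a + 1) b 0) with hle | hle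
            · obtain ⟨S, hk, hm, hS⟩ := (ihb (k - 1)).mp (by omega)
              refine ⟨S, hk, hm, fun x hx => ⟨?_, by have := hS x hx; omega⟩⟩
              have h1 := hS x hx
              by_contra hxa
              have : x = x₀ := Fin.ext (by simp only [hx₀]; omega)
              rw [this] at h1
              omega
            · exact (iha (b + 1) (k - 1)).mp (by omega)
          have hx : x₀ ∉ S := fun hx => by have := (hS _ hx).1; simp [hx₀] at this
          refine ⟨insert x₀ S, by rw [Finset.card_insert_of_notMem hx]; omega, ?_, ?_⟩
          · intro x hx y hy hxy
            simp only [Finset.coe_insert, Set.mem_insert_iff, Finset.mem_coe] at hx hy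
            rcases hy with rfl | hy
            · rcases hx with rfl | hx
              · exact le_rfl
              · rw [hc]; exact (hS x hx).2
            · rcases hx with rfl | hx
              · have := (hS y hy).1
                rw [Fin.le_def] at hxy
                simp only [hx₀] at hxy
                omega
              · exact hm hx hy hxy
          · intro x hx
            rcases Finset.mem_insert.mp hx with rfl | hx
            · exact ⟨by simp [hx₀], hc.le⟩
            · have := hS x hx; omega
        · rw [if_neg hc] at hA
          rcases le_total (growth (wordMatrix w) a (b + 1) 0)
            (growth (wordMatrix w) (a + 1) b 0) with hle | hle
          · obtain ⟨S, hk, hm, hS⟩ := (ihb k).mp (by omega)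
            exact ⟨S, hk, hm, fun x hx => by have := hS x hx; omega⟩
          · obtain ⟨S, hk, hm, hS⟩ := (iha (b + 1) k).mp (by omega)
            exact ⟨S, hk, hm, fun x hx => by have := hS x hx; omega⟩
      · rintro ⟨S, hk, hm, hS⟩
        by_cases hx : x₀ ∈ S
        · by_cases hc : w x₀ = b + 1
          · rw [if_pos hc] at hA
            have := (iha (b + 1) (k - 1)).mpr ⟨S.erase x₀, by
              rw [Finset.card_erase_of_mem hx]; omega,
              hm.mono (by simp), fun x hxS => by
                obtain ⟨hne, hxS⟩ := Finset.mem_erase.mp hxS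
                have h1 := hS x hxS
                refine ⟨?_, h1.2⟩
                have : (x : ℕ) ≠ a := fun h => hne (Fin.ext h)
                omega⟩
            omega
          -- Since `x₀` is the last position, monotonicity bounds every letter of `S` by `w x₀`,
          -- which is at most b.
          · have h0 := hS _ hx
            have := (ihb k).mpr ⟨S, hk, hm, fun x hxS => by
              have h1 := hS x hxS
              have h2 : w x ≤ w x₀ := hm hxS hx (by rw [Fin.le_def]; simp only [hx₀]; omega)
              omega⟩
            omega
        · have := (iha (b + 1) k).mpr ⟨S, hk, hm, fun x hxS => by
            have h1 := hS x hxS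
            refine ⟨?_, h1.2⟩
            have : (x : ℕ) ≠ a := fun h => hx (by rwa [← show x = x₀ from Fin.ext h])
            omega⟩
          omega

/-! ### The RSK bijection for regular words -/

theorem growth_congr {A B : ℕ → ℕ → ℕ} {n m : ℕ} (h : ∀ i < n, ∀ j < m, A i j = B i j) :
    ∀ i ≤ n, ∀ j ≤ m, growth A i j = growth B i j := by
  intro i
  induction i with
  | zero => intro _ j _; rw [growth_zero_left, growth_zero_left]
  | succ i ih =>
    intro hi j
    induction j with
    | zero => intro _; rw [growth_zero_right, growth_zero_right]
    | succ j ihj =>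
      intro hj
      funext k
      cases k with
      | zero => rw [growth_succ_zero, growth_succ_zero, ihj (by omega), ih (by omega) _ hj,
          h i (by omega) j (by omega)]
      | succ k => rw [growth_succ_succ, growth_succ_succ, ihj (by omega), ih (by omega) _ hj,
          ih (by omega) j (by omega)]

/-- Chains of shapes from the empty shape to `s` in `m` steps, each step adding a horizontal strip
of size `r`; sizes are computed on the first `N` rows. -/
def chains (N m r : ℕ) (s : ℕ → ℕ) : Set (ℕ → ℕ → ℕ) :=
  {P | P 0 = 0 ∧ (∀ j, Interlaces (P j) (P (j + 1))) ∧ (∀ j, m ≤ j → P j = s) ∧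
    ∀ j < m, ∑ k ∈ Finset.range N, P (j + 1) k = ∑ k ∈ Finset.range N, P j k + r}

theorem Interlaces.self_left {s t : ℕ → ℕ} (h : Interlaces s t) : Interlaces s s :=
  fun k => ⟨le_rfl, (h (k + 1)).1.trans (h k).2⟩

/-- Freezing a chain after step m gives it a unique representative among functions on ℕ, so that
`chains` can be counted. -/
theorem clamp_mem_chains {P : ℕ → ℕ → ℕ} {N m r : ℕ} (h0 : P 0 = 0)
    (hP : ∀ j, Interlaces (P j) (P (j + 1)))
    (hs : ∀ j < m, ∑ k ∈ Finset.range N, P (j + 1) k = ∑ k ∈ Finset.range N, P j k + r) :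
    (fun j => P (min j m)) ∈ chains N m r (P m) := by
  refine ⟨by simpa using h0, fun j => ?_, fun j hj => by simp [hj], fun j hj => ?_⟩
  · rcases lt_or_ge j m with hj | hj
    · simp only [min_eq_left hj.le, min_eq_left (Nat.succ_le_of_lt hj)]
      exact hP j
    · simp only [min_eq_right hj, min_eq_right (hj.trans (Nat.le_succ j))]
      exact (hP m).self_left
  · simp only [min_eq_left hj.le, min_eq_left (Nat.succ_le_of_lt hj)]
    exact hs j hj

/-- The Robinson–Schensted–Knuth correspondence for regular words, refined by shape. -/
theorem ncard_words_of_shape {n m r : ℕ} (hn : m * r = n) (s : ℕ → ℕ) :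
    {w : Fin n → ℕ | IsRegularWord m r w ∧ growth (wordMatrix w) n m = s}.ncard =
      (chains n m r s).ncard * (chains n n 1 s).ncard := by
  rw [← Set.ncard_prod]
  refine Set.ncard_congr (fun w _ => (fun j => growth (wordMatrix w) n (min j m),
    fun i => growth (wordMatrix w) (min i n) m)) ?_ ?_ ?_
  · rintro w ⟨hw, rfl⟩
    refine ⟨clamp_mem_chains (growth_zero_right _ _)
      (fun j => (growth_interlaces _ n j).2) fun j hj => ?_,
      clamp_mem_chains (P := fun i => growth (wordMatrix w) i m) (growth_zero_left _ _)
      (fun i => (growth_interlaces _ i m).1) fun i hi => ?_⟩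
    · rw [sum_growth_succ_right _ _ le_rfl, sum_wordMatrix_col,
        hw _ (Finset.mem_Icc.mpr (by omega))]
    · rw [sum_growth_succ_left _ _ hi, sum_wordMatrix_row ⟨i, hi⟩ (hw.mem_Icc hn _)]
  · rintro w w' ⟨hw, -⟩ ⟨hw', -⟩ h
    rw [Prod.mk.injEq] at h
    funext i
    have h1 := hw.mem_Icc hn i
    rw [Finset.mem_Icc] at h1
    -- This entry is 1 for `w`, so it must be 1 for `w'`, which identifies the letter.
    have h2 : wordMatrix w i (w i - 1) = wordMatrix w' i (w i - 1) := by
      refine growth_injective (n := n) (m := m) (fun j hj => ?_) (fun i hi => ?_) i.2 (by omega)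
      · simpa [hj] using congrFun h.1 j
      · simpa [hi] using congrFun h.2 i
    rw [wordMatrix_val, wordMatrix_val, if_pos (by omega)] at h2
    by_contra hne
    rw [if_neg (by omega)] at h2
    omega
  · rintro ⟨P, Q⟩ ⟨⟨hP0, hP, hPs, hPr⟩, hQ0, hQ, hQs, hQr⟩
    dsimp only at hP0 hP hPs hPr hQ0 hQ hQs hQr
    obtain ⟨A, hAP, hAQ⟩ := exists_growth_eq ((hPs m le_rfl).trans (hQs n le_rfl).symm)
      hP0 hQ0 hP hQ
    have hrow : ∀ i < n, ∑ j ∈ Finset.range m, A i j = 1 := fun i hi => by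
      have h1 := sum_growth_succ_left A m hi
      rw [hAQ _ hi, hAQ _ hi.le, hQr i hi] at h1
      omega
    have hcol : ∀ j < m, ∑ i ∈ Finset.range n, A i j = r := fun j hj => by
      have h1 := sum_growth_succ_right A j (le_refl n)
      rw [hAP _ hj, hAP _ hj.le, hPr j hj] at h1
      omega
    -- A row of natural numbers with sum 1 has a single nonzero entry, equal to 1; its column gives
    -- the letter.
    have hex : ∀ i : Fin n, ∃ j < m, A i j = 1 ∧ ∀ j' < m, j' ≠ j → A i j' = 0 := fun i => by
      have h1 := hrow i i.2
      obtain ⟨j, hj, hne⟩ := Finset.exists_ne_zero_of_sum_ne_zero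
        (by rw [h1]; exact one_ne_zero : ∑ j ∈ Finset.range m, A i j ≠ 0)
      rw [← Finset.add_sum_erase _ _ hj] at h1
      refine ⟨j, Finset.mem_range.mp hj, by omega, fun j' hj' hjj' => ?_⟩
      exact Finset.sum_eq_zero_iff.mp (by omega : ∑ j ∈ (Finset.range m).erase j, A i j = 0) j'
        (Finset.mem_erase.mpr ⟨hjj', Finset.mem_range.mpr hj'⟩)
    choose v hv hv1 hv0 using hex
    have hAw : ∀ i < n, ∀ j < m, wordMatrix (fun i => v i + 1) i j = A i j := by
      intro i hi j hj
      rw [wordMatrix_val _ ⟨i, hi⟩]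
      by_cases h : v ⟨i, hi⟩ = j
      · rw [if_pos (by omega), ← hv1 ⟨i, hi⟩, h]
      · rw [if_neg (by omega), hv0 ⟨i, hi⟩ j hj (Ne.symm h)]
    have hG := growth_congr hAw
    refine ⟨fun i => v i + 1, ⟨fun j hj => ?_, ?_⟩, ?_⟩
    · rw [Finset.mem_Icc] at hj
      obtain ⟨j, rfl⟩ : ∃ l, j = l + 1 := ⟨j - 1, by omega⟩
      rw [← sum_wordMatrix_col, ← hcol j (by omega)]
      exact Finset.sum_congr rfl fun i hi => hAw i (Finset.mem_range.mp hi) j (by omega)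
    · rw [hG n le_rfl m le_rfl, hAP m le_rfl, hPs m le_rfl]
    · rw [Prod.mk.injEq]
      constructor
      · funext j
        rw [hG n le_rfl _ (min_le_right _ _), hAP _ (min_le_right _ _)]
        rcases le_total j m with hj | hj
        · rw [min_eq_left hj]
        · rw [min_eq_right hj, hPs _ le_rfl, hPs _ hj]
      · funext i
        rw [hG _ (min_le_right _ _) m le_rfl, hAQ _ (min_le_right _ _)]
        rcases le_total i n with hi | hi
        · rw [min_eq_left hi]
        · rw [min_eq_right hi, hQs _ le_rfl, hQs _ hi]

/-! ### Tableaux as chains of horizontal strips -/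

theorem card_eq_sum_of_mem_iff {D : Finset (ℕ × ℕ)} {f : ℕ → ℕ} {N : ℕ}
    (hD : ∀ k c, (k, c) ∈ D ↔ c < f k) (hN : ∀ k, N ≤ k → f k = 0) :
    D.card = ∑ k ∈ Finset.range N, f k := by
  rw [Finset.card_eq_sum_card_fiberwise (f := Prod.fst) (t := Finset.range N)]
  · refine Finset.sum_congr rfl fun k _ => ?_
    have : D.filter (fun x => x.1 = k) = {k} ×ˢ Finset.range (f k) := by
      ext ⟨a, c⟩
      simp only [Finset.mem_filter, Finset.mem_product, Finset.mem_singleton, Finset.mem_range, hD]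
      constructor
      · rintro ⟨h, rfl⟩; exact ⟨rfl, h⟩
      · rintro ⟨rfl, h⟩; exact ⟨h, rfl⟩
    rw [this]
    simp
  · rintro ⟨k, c⟩ h
    have h := (hD k c).mp h
    simp only [Finset.coe_range, Set.mem_Iio]
    by_contra hk
    rw [hN k (by omega)] at h
    omega

variable {μ : YoungDiagram}

theorem exists_notMem_and_le (T : SemistandardYoungTableau μ) (j k : ℕ) :
    ∃ c, ¬((k, c) ∈ μ ∧ T k c ≤ j) := by
  obtain ⟨c, hc⟩ := μ.exists_notMem_row k
  exact ⟨c, fun h => hc h.1⟩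

open Classical in
/-- The shape of the part of `T` with entries at most `j`. -/
noncomputable def tableauChain (T : SemistandardYoungTableau μ) (j k : ℕ) : ℕ :=
  Nat.find (exists_notMem_and_le T j k)

theorem lt_tableauChain_iff (T : SemistandardYoungTableau μ) (j k c : ℕ) :
    c < tableauChain T j k ↔ (k, c) ∈ μ ∧ T k c ≤ j := by
  classical
  rw [tableauChain, Nat.lt_find_iff]
  constructor
  · intro h; exact not_not.mp (h c le_rfl)
  · rintro ⟨h1, h2⟩ c' hc'
    exact not_not.mpr ⟨μ.up_left_mem le_rfl hc' h1, (T.row_weak_of_le hc' h1).trans h2⟩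

/-- Stated for any `P` describing the sublevel sets of `T`, so that it serves both directions of the
bijection. -/
theorem sum_succ_eq_add_entryCount {T : SemistandardYoungTableau μ} {P : ℕ → ℕ → ℕ} {N : ℕ}
    (hP : ∀ j k c, c < P j k ↔ (k, c) ∈ μ ∧ T k c ≤ j) (hN : ∀ k, N ≤ k → μ.rowLen k = 0)
    (j : ℕ) : ∑ k ∈ Finset.range N, P (j + 1) k =
      ∑ k ∈ Finset.range N, P j k + entryCount T (j + 1) := by
  have hsum : ∀ j, (μ.cells.filter fun c => T c.1 c.2 ≤ j).card =
      ∑ k ∈ Finset.range N, P j k := by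
    intro j
    refine card_eq_sum_of_mem_iff (fun k c => ?_) fun k hk => ?_
    · rw [hP, Finset.mem_filter, YoungDiagram.mem_cells]
    · by_contra h
      have := ((hP j k 0).mp (Nat.pos_of_ne_zero h)).1
      rw [YoungDiagram.mem_iff_lt_rowLen, hN k hk] at this
      omega
  rw [← hsum, ← hsum, entryCount, ← Finset.card_union_of_disjoint]
  · congr 1
    ext c
    simp only [Finset.mem_filter, Finset.mem_union, ← and_or_left, Nat.le_succ_iff]
  · rw [Finset.disjoint_filter]
    intro c _ h
    omega

/-- The tableau of a chain of shapes. -/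
noncomputable def chainTableau {m : ℕ} (P : ℕ → ℕ → ℕ) (h0 : P 0 = 0)
    (hP : ∀ j, Interlaces (P j) (P (j + 1))) (hm : P m = μ.rowLen) :
    SemistandardYoungTableau μ := by
  classical
  -- The entry of a cell is the first step whose shape contains it; step m does, so the infimum is
  -- attained.
  have hne : ∀ {k c}, (k, c) ∈ μ → c < P (sInf {j | c < P j k}) k := fun {k c} h =>
    Nat.sInf_mem (s := {j | c < P j k})
      ⟨m, by rw [Set.mem_ofPred_eq, hm]; exact YoungDiagram.mem_iff_lt_rowLen.mp h⟩
  exact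
    { entry := fun k c => if (k, c) ∈ μ then sInf {j | c < P j k} else 0
      row_weak' := by
        intro k c1 c2 hc h
        rw [if_pos h, if_pos (μ.up_left_mem le_rfl hc.le h)]
        exact Nat.sInf_le (hc.trans (hne h))
      col_strict' := by
        intro k1 k2 c hk h
        rw [if_pos h, if_pos (μ.up_left_mem hk.le le_rfl h)]
        have h2 := hne h
        obtain ⟨k, rfl⟩ : ∃ k, k2 = k + 1 := ⟨k2 - 1, by omega⟩
        generalize sInf {j | c < P j (k + 1)} = j at h2
        cases j with
        | zero => rw [h0] at h2; simp at h2
        | succ j =>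
          have hanti : Antitone (P j) :=
            antitone_nat_of_succ_le fun k => ((hP j).self_left k).2
          refine Nat.lt_succ_of_le (Nat.sInf_le ?_)
          exact h2.trans_le (((hP j k).2).trans (hanti (by omega)))
      zeros' := fun h => if_neg h }

theorem lt_iff_chainTableau_le {m : ℕ} {P : ℕ → ℕ → ℕ} (h0 : P 0 = 0)
    (hP : ∀ j, Interlaces (P j) (P (j + 1))) (hm : ∀ j, m ≤ j → P j = μ.rowLen) (j k c : ℕ) :
    c < P j k ↔ (k, c) ∈ μ ∧ chainTableau P h0 hP (hm m le_rfl) k c ≤ j := by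
  classical
  have hT : (chainTableau P h0 hP (hm m le_rfl)) k c =
      if (k, c) ∈ μ then sInf {j | c < P j k} else 0 := rfl
  have hmono : Monotone fun j => P j k := monotone_nat_of_le_succ fun j => (hP j k).1
  constructor
  · intro h
    have hmem : (k, c) ∈ μ := by
      rw [YoungDiagram.mem_iff_lt_rowLen, ← hm (max j m) (le_max_right _ _)]
      exact h.trans_le (hmono (le_max_left _ _))
    refine ⟨hmem, ?_⟩
    rw [hT, if_pos hmem]
    exact Nat.sInf_le h
  · rintro ⟨hmem, h⟩
    rw [hT, if_pos hmem] at h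
    have : c < P (sInf {j | c < P j k}) k := Nat.sInf_mem (s := {j | c < P j k})
      ⟨m, by rw [Set.mem_ofPred_eq, hm m le_rfl]; exact YoungDiagram.mem_iff_lt_rowLen.mp hmem⟩
    exact this.trans_le (hmono h)

/-- Semistandard tableaux of shape `μ` with content `(r, …, r)` correspond to chains. -/
theorem card_tableaux_eq_ncard_chains (μ : YoungDiagram) {N m r : ℕ} (hμ : m * r = μ.card)
    (hN : ∀ k, N ≤ k → μ.rowLen k = 0) :
    Nat.card {T : SemistandardYoungTableau μ // ∀ j ∈ Finset.Icc 1 m, entryCount T j = r} =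
      (chains N m r μ.rowLen).ncard := by
  have hle : ∀ {a b : ℕ}, (∀ c, c < a → c < b) → a ≤ b := fun {a b} h => by
    by_contra hab
    exact lt_irrefl _ (h b (by omega))
  refine (Nat.card_coe_set_eq {T : SemistandardYoungTableau μ |
    ∀ j ∈ Finset.Icc 1 m, entryCount T j = r}).trans ?_
  refine Set.ncard_congr (fun T _ => tableauChain T) ?_ ?_ ?_
  · intro T hT
    -- No entry is 0 or exceeds m, so the chain starts empty and has reached `μ` by step m.
    have hent : ∀ {k c}, (k, c) ∈ μ → T k c ∈ Finset.Icc 1 m := fun {k c} h =>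
      mem_Icc_of_card_fibers (s := μ.cells) (f := fun c => T c.1 c.2) hT hμ (x := (k, c)) h
    refine ⟨?_, fun j k => ⟨?_, ?_⟩, fun j hj => ?_, fun j hj => ?_⟩
    · funext k
      refine Nat.eq_zero_of_le_zero (hle fun c hc => ?_)
      obtain ⟨h1, h2⟩ := (lt_tableauChain_iff T 0 k c).mp hc
      have := Finset.mem_Icc.mp (hent h1)
      omega
    · refine hle fun c hc => ?_
      rw [lt_tableauChain_iff] at hc ⊢
      exact ⟨hc.1, hc.2.trans (Nat.le_succ j)⟩
    · refine hle fun c hc => ?_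
      rw [lt_tableauChain_iff] at hc ⊢
      have := T.col_strict (Nat.lt_add_one k) hc.1
      exact ⟨μ.up_left_mem (Nat.le_succ k) le_rfl hc.1, by omega⟩
    · funext k
      refine le_antisymm (hle fun c hc => ?_) (hle fun c hc => ?_)
      · rw [lt_tableauChain_iff] at hc
        exact YoungDiagram.mem_iff_lt_rowLen.mp hc.1
      · rw [lt_tableauChain_iff]
        have hc := YoungDiagram.mem_iff_lt_rowLen.mpr hc
        exact ⟨hc, (Finset.mem_Icc.mp (hent hc)).2.trans hj⟩
    · rw [sum_succ_eq_add_entryCount (lt_tableauChain_iff T) hN,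
        hT _ (Finset.mem_Icc.mpr (by omega))]
  · intro T T' _ _ h
    have key : ∀ (T T' : SemistandardYoungTableau μ), tableauChain T = tableauChain T' →
        ∀ k c, T k c ≤ T' k c := by
      intro T T' h k c
      by_cases hc : (k, c) ∈ μ
      · exact ((lt_tableauChain_iff T _ k c).mp
          (h ▸ (lt_tableauChain_iff T' (T' k c) k c).mpr ⟨hc, le_rfl⟩)).2
      · rw [T.zeros hc]; exact Nat.zero_le _
    exact SemistandardYoungTableau.ext fun k c =>
      le_antisymm (key T T' h k c) (key T' T h.symm k c)
  · rintro P ⟨h0, hP, hm, hr⟩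
    have hiff := lt_iff_chainTableau_le h0 hP hm
    refine ⟨chainTableau P h0 hP (hm m le_rfl), fun j hj => ?_, ?_⟩
    · rw [Finset.mem_Icc] at hj
      obtain ⟨j, rfl⟩ : ∃ l, j = l + 1 := ⟨j - 1, by omega⟩
      have h1 := sum_succ_eq_add_entryCount hiff hN j
      rw [hr j (by omega)] at h1
      omega
    · funext j k
      refine le_antisymm (hle fun c hc => ?_) (hle fun c hc => ?_)
      · exact (hiff j k c).mpr ((lt_tableauChain_iff _ j k c).mp hc)
      · exact (lt_tableauChain_iff _ j k c).mpr ((hiff j k c).mp hc)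

/-! ### Standardization and the sphere around the identity -/

/-- The zero-based rank of position `i` when positions are sorted by letter, then by index. -/
def standardRank {n : ℕ} (w : Fin n → ℕ) (i : Fin n) : ℕ :=
  (Finset.univ.filter fun x => w x < w i ∨ (w x = w i ∧ x < i)).card

theorem standardRank_lt_of_lex {n : ℕ} {w : Fin n → ℕ} {a b : Fin n}
    (h : w a < w b ∨ (w a = w b ∧ a < b)) : standardRank w a < standardRank w b := by
  refine Finset.card_lt_card (Finset.ssubset_iff_of_subset (fun x hx => ?_) |>.mpr ⟨a, ?_, ?_⟩)
  · simp only [Finset.mem_filter, Finset.mem_univ, true_and] at hx ⊢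
    omega
  · simpa using h
  · simp

theorem standardRank_lt {n : ℕ} (w : Fin n → ℕ) (i : Fin n) : standardRank w i < n := by
  have : standardRank w i < (Finset.univ : Finset (Fin n)).card :=
    Finset.card_lt_card (Finset.filter_ssubset.mpr ⟨i, Finset.mem_univ i, by simp⟩)
  simpa using this

/-- The standardization of a word. -/
noncomputable def standardization {n : ℕ} (w : Fin n → ℕ) : Equiv.Perm (Fin n) :=
  Equiv.ofBijective (fun i => ⟨standardRank w i, standardRank_lt w i⟩) <| by
    refine Finite.injective_iff_bijective.mp fun a b h => ?_
    have h : standardRank w a = standardRank w b := congrArg Fin.val h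
    by_contra hne
    rcases lt_trichotomy (w a) (w b) with hw | hw | hw
    · exact h.not_lt (standardRank_lt_of_lex (Or.inl hw))
    · rcases lt_or_gt_of_ne hne with hab | hab
      · exact h.not_lt (standardRank_lt_of_lex (Or.inr ⟨hw, hab⟩))
      · exact h.not_gt (standardRank_lt_of_lex (Or.inr ⟨hw.symm, hab⟩))
    · exact h.not_gt (standardRank_lt_of_lex (Or.inl hw))

/-- The rank of i is (w i - 1) r plus the number of earlier equal letters, which is less than r;
division by r recovers w i - 1. -/
theorem multiperm_standardization {n m r : ℕ} {w : Fin n → ℕ} (hn : m * r = n)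
    (hw : IsRegularWord m r w) : multiperm r (standardization w) = w := by
  funext i
  have hi := Finset.mem_Icc.mp (hw.mem_Icc hn i)
  have h1 : standardRank w i = (Finset.univ.filter fun x => w x < w i).card +
      (Finset.univ.filter fun x => w x = w i ∧ x < i).card := by
    rw [standardRank, Finset.filter_or, Finset.card_union_of_disjoint]
    rw [Finset.disjoint_filter]
    intro x _ h
    omega
  have h2 : (Finset.univ.filter fun x => w x < w i).card = (w i - 1) * r := by
    have h := Finset.sum_card_fiberwise_eq_card_filter Finset.univ (Finset.Icc 1 (w i - 1)) w
    rw [Finset.sum_congr rfl fun j hj => hw j (Finset.mem_Icc.mpr (by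
      have := Finset.mem_Icc.mp hj; omega)), Finset.sum_const, Nat.card_Icc, smul_eq_mul,
      Nat.add_sub_cancel] at h
    rw [h]
    congr 1
    ext x
    have := Finset.mem_Icc.mp (hw.mem_Icc hn x)
    simp only [Finset.mem_filter, Finset.mem_univ, true_and, Finset.mem_Icc]
    omega
  have h3 : (Finset.univ.filter fun x => w x = w i ∧ x < i).card < r := by
    rw [← hw (w i) (hw.mem_Icc hn i)]
    refine Finset.card_lt_card (Finset.ssubset_iff_of_subset (fun x hx => ?_) |>.mpr ⟨i, ?_, ?_⟩)
    · simp only [Finset.mem_filter, Finset.mem_univ, true_and] at hx ⊢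
      exact hx.1
    · simp
    · simp
  have h4 : standardRank w i / r = w i - 1 := by
    rw [h1, h2, Nat.div_eq_iff (by omega)]
    omega
  change standardRank w i / r + 1 = w i
  omega

theorem isRegularWord_multiperm {n m r : ℕ} (hr : 0 < r) (hn : m * r = n)
    (π : Equiv.Perm (Fin n)) : IsRegularWord m r (multiperm r π) := by
  intro j hj
  rw [Finset.mem_Icc] at hj
  have hj2 : j * r ≤ n := hn ▸ Nat.mul_le_mul_right r hj.2
  have hj3 : (j - 1) * r + r = j * r := by
    obtain ⟨j, rfl⟩ : ∃ l, j = l + 1 := ⟨j - 1, by omega⟩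
    rw [Nat.add_sub_cancel, Nat.succ_mul]
  have hiff : ∀ i, multiperm r π i = j ↔ (j - 1) * r ≤ π i ∧ (π i : ℕ) < j * r := fun i => by
    rw [multiperm_eq_iff hr π i j hj.1, permSeq]
    omega
  have hc : (Finset.Ico ((j - 1) * r) (j * r)).card = r := by rw [Nat.card_Ico]; omega
  refine (Finset.card_bij (fun i _ => (π i : ℕ)) ?_ ?_ ?_).trans hc
  · intro i hi
    simpa [hiff] using hi
  · intro a _ b _ h
    exact π.injective (Fin.ext h)
  · intro x hx
    rw [Finset.mem_Ico] at hx
    exact ⟨π.symm ⟨x, by omega⟩, by simpa [hiff] using hx, by simp⟩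

/-- The sphere around the identity consists of the regular words with a long weakly increasing
subsequence. -/
theorem mem_ulamSphere_one_iff {n m r : ℕ} (hr : 0 < r) (hn : m * r = n) (t : ℕ)
    (w : Fin n → ℕ) : w ∈ ulamSphere r (1 : Equiv.Perm (Fin n)) t ↔
      IsRegularWord m r w ∧ n - t ≤ growth (wordMatrix w) n m 0 := by
  have hlis : IsRegularWord m r w → (n - t ≤ growth (wordMatrix w) n m 0 ↔
      ∃ S : Finset (Fin n), n - t ≤ S.card ∧ MonotoneOn w S) := fun hw => by
    have hI := fun i => Finset.mem_Icc.mp (hw.mem_Icc hn i)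
    rw [le_growth_wordMatrix_iff (fun i => (hI i).1) n le_rfl]
    exact ⟨fun ⟨S, h1, h2, _⟩ => ⟨S, h1, h2⟩,
      fun ⟨S, h1, h2⟩ => ⟨S, h1, h2, fun x _ => ⟨x.2, (hI x).2⟩⟩⟩
  constructor
  · rintro ⟨π, rfl, hd⟩
    have hreg := isRegularWord_multiperm hr hn π
    refine ⟨hreg, (hlis hreg).mpr ?_⟩
    obtain ⟨σ', hσ, π', hπ, he⟩ := Nat.sInf_mem
      (s := {d : ℕ | ∃ σ' ∈ eqvClass r (1 : Equiv.Perm (Fin n)), ∃ π' ∈ eqvClass r π,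
        d = ulamDist σ' π'}) ⟨_, 1, rfl, π, rfl, rfl⟩
    change regUlamDist r 1 π = _ at he
    rw [he, ulamDist] at hd
    obtain ⟨a, b, ha, hb, hab⟩ := (lcsLength_isGreatest (permSeq σ') (permSeq π')).1
    -- At the positions `b p`, the letter of `π` equals the letter of the identity at `a p`, which
    -- is weakly increasing in p.
    refine ⟨Finset.univ.image b, ?_, ?_⟩
    · rw [Finset.card_image_of_injective _ hb.injective, Finset.card_fin]
      omega
    · have hval : ∀ p, multiperm r π (b p) = (a p : ℕ) / r + 1 := fun p => by
        have h1 : multiperm r π' = multiperm r π := hπ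
        have h2 : multiperm r σ' = multiperm r 1 := hσ
        have h3 : (a p : ℕ) / r + 1 = multiperm r 1 (a p) := rfl
        have h4 := hab p
        simp only [permSeq, Nat.add_right_cancel_iff] at h4
        rw [h3, ← h1, ← h2, multiperm, multiperm, h4]
      intro x hx y hy hxy
      obtain ⟨p, rfl⟩ : ∃ p, b p = x := by simpa using hx
      obtain ⟨q, rfl⟩ : ∃ q, b q = y := by simpa using hy
      rw [hval, hval]
      have := ha.monotone (hb.le_iff_le.mp hxy)
      exact Nat.succ_le_succ (Nat.div_le_div_right this)
  · rintro ⟨hw, hg⟩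
    obtain ⟨S, hS, hm⟩ := (hlis hw).mp hg
    have hπ := multiperm_standardization hn hw
    refine ⟨standardization w, hπ.symm, ?_⟩
    have h1 : regUlamDist r 1 (standardization w) ≤ ulamDist 1 (standardization w) :=
      Nat.sInf_le ⟨1, rfl, _, rfl, rfl⟩
    have h2 : S.card ≤ lcsLength (permSeq (1 : Equiv.Perm (Fin n)))
        (permSeq (standardization w)) := by
      -- In the identity each value is its own position, so the values of the standardization on `S`
      -- serve as positions there.
      refine (lcsLength_isGreatest _ _).2
        ⟨fun p => standardization w (S.orderEmbOfFin rfl p), S.orderEmbOfFin rfl, ?_,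
          (S.orderEmbOfFin rfl).strictMono, fun p => rfl⟩
      intro p q hpq
      have hlt := (S.orderEmbOfFin rfl).strictMono hpq
      have hle := hm (S.orderEmbOfFin_mem rfl p) (S.orderEmbOfFin_mem rfl q) hlt.le
      exact standardRank_lt_of_lex (hle.lt_or_eq.imp id fun h => ⟨h, hlt⟩)
    rw [ulamDist] at h1
    omega

/-! ### Partitions, Young diagrams and row lengths -/

theorem diagram_rowLens {n : ℕ} (lam : n.Partition) :
    (diagram lam).rowLens = lam.parts.sort (· ≥ ·) :=
  YoungDiagram.rowLens_ofRowLens_eq_self fun _ hx => lam.parts_pos ((Multiset.mem_sort _).mp hx)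

theorem card_eq_sum_rowLens (μ : YoungDiagram) : μ.card = μ.rowLens.sum := by
  have hsum : μ.rowLens.sum = ∑ k ∈ Finset.range (μ.colLen 0), μ.rowLen k := by
    rw [YoungDiagram.rowLens, ← Multiset.sum_coe]
    rfl
  rw [hsum]
  refine card_eq_sum_of_mem_iff (fun k c => YoungDiagram.mem_iff_lt_rowLen) fun k hk => ?_
  by_contra h
  have := YoungDiagram.mem_iff_lt_colLen.mp
    (YoungDiagram.mem_iff_lt_rowLen.mpr (Nat.pos_of_ne_zero h))
  omega

theorem card_diagram {n : ℕ} (lam : n.Partition) : (diagram lam).card = n := by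
  rw [card_eq_sum_rowLens, diagram_rowLens, ← Multiset.sum_coe, Multiset.sort_eq, lam.parts_sum]

theorem rowLen_eq_zero_of_card_le (μ : YoungDiagram) {k : ℕ} (hk : μ.card ≤ k) :
    μ.rowLen k = 0 := by
  by_contra h
  have h1 := YoungDiagram.mem_iff_lt_colLen.mp
    (YoungDiagram.mem_iff_lt_rowLen.mpr (Nat.pos_of_ne_zero h))
  have h2 : μ.colLen 0 ≤ μ.card := by
    rw [YoungDiagram.colLen_eq_card]
    exact Finset.card_le_card (Finset.filter_subset _ _)
  omega

theorem youngDiagram_eq_of_rowLen_eq {μ ν : YoungDiagram} (h : μ.rowLen = ν.rowLen) : μ = ν := by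
  ext ⟨k, c⟩
  rw [YoungDiagram.mem_cells, YoungDiagram.mem_cells, YoungDiagram.mem_iff_lt_rowLen,
    YoungDiagram.mem_iff_lt_rowLen, h]

theorem rowLen_diagram_injective {n : ℕ} :
    Function.Injective fun lam : n.Partition => (diagram lam).rowLen := by
  intro lam lam' h
  have h1 := diagram_rowLens lam
  rw [youngDiagram_eq_of_rowLen_eq h, diagram_rowLens] at h1
  apply Nat.Partition.ext
  rw [← Multiset.sort_eq lam.parts (· ≥ ·), ← h1, Multiset.sort_eq]

theorem exists_diagram_eq {n : ℕ} (μ : YoungDiagram) (h : μ.card = n) :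
    ∃ lam : n.Partition, diagram lam = μ := by
  refine ⟨⟨μ.rowLens, fun {i} hi => μ.pos_of_mem_rowLens i hi, ?_⟩, ?_⟩
  · rw [Multiset.sum_coe, ← card_eq_sum_rowLens, h]
  · apply YoungDiagram.equivListRowLens.injective
    apply Subtype.ext
    change (diagram _).rowLens = μ.rowLens
    rw [diagram_rowLens]
    refine List.Perm.eq_of_sortedGE ?_ μ.rowLens_sorted ?_
    · exact (Multiset.pairwise_sort _ _).sortedGE
    · rw [← Multiset.coe_eq_coe, Multiset.sort_eq]

theorem exists_diagram_rowLen_eq {n : ℕ} {s : ℕ → ℕ} (hs : Antitone s)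
    (h0 : ∀ k, n ≤ k → s k = 0) (hsum : ∑ k ∈ Finset.range n, s k = n) :
    ∃ lam : n.Partition, (diagram lam).rowLen = s := by
  have hmem : ∀ k c, (k, c) ∈ (Finset.range n ×ˢ Finset.range (s 0)).filter (fun c => c.2 < s c.1)
      ↔ c < s k := by
    intro k c
    simp only [Finset.mem_filter, Finset.mem_product, Finset.mem_range, and_iff_right_iff_imp]
    intro h
    refine ⟨?_, h.trans_le (hs (Nat.zero_le k))⟩
    by_contra hk
    rw [h0 k (by omega)] at h
    omega
  let μ : YoungDiagram :=
    { cells := (Finset.range n ×ˢ Finset.range (s 0)).filter (fun c => c.2 < s c.1)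
      isLowerSet := by
        rintro ⟨k, c⟩ ⟨k', c'⟩ hle h
        rw [Finset.mem_coe, hmem] at h ⊢
        exact (hle.2.trans_lt h).trans_le (hs hle.1) }
  have hrow : μ.rowLen = s := by
    funext k
    have : ∀ c, c < μ.rowLen k ↔ c < s k := fun c => by
      rw [← YoungDiagram.mem_iff_lt_rowLen]
      exact hmem k c
    exact le_antisymm (not_lt.mp fun h => lt_irrefl _ ((this _).mp h))
      (not_lt.mp fun h => lt_irrefl _ ((this _).mpr h))
  obtain ⟨lam, hlam⟩ := exists_diagram_eq (n := n) μ ((card_eq_sum_of_mem_iff hmem h0).trans hsum)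
  exact ⟨lam, by rw [hlam, hrow]⟩

/-- The shape of a regular word. -/
theorem exists_diagram_rowLen_eq_growth {n m r : ℕ} {w : Fin n → ℕ} (hn : m * r = n)
    (hw : IsRegularWord m r w) :
    ∃ lam : n.Partition, (diagram lam).rowLen = growth (wordMatrix w) n m := by
  refine exists_diagram_rowLen_eq (antitone_nat_of_succ_le fun k =>
    ((growth_interlaces (wordMatrix w) n m).1.self_left k).2)
    (fun k hk => growth_eq_zero _ n m k hk) ?_
  -- Each letter adds one cell.
  have : ∀ i ≤ n, ∑ k ∈ Finset.range n, growth (wordMatrix w) i m k = i := by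
    intro i
    induction i with
    | zero => intro _; simp [growth_zero_left]
    | succ i ih =>
      intro hi
      rw [sum_growth_succ_left _ _ hi, ih (by omega),
        sum_wordMatrix_row ⟨i, hi⟩ (hw.mem_Icc hn _)]
  exact this n le_rfl

/-- Standard tableaux are the case of n letters, each used once, so both factors come from the same
chain count. Truncating at n rows loses nothing for a diagram with n cells. -/
theorem ncard_words_of_diagram {n m r : ℕ} (hr : 0 < r) (hn : m * r = n) (lam : n.Partition) :
    {w : Fin n → ℕ | IsRegularWord m r w ∧
      growth (wordMatrix w) n m = (diagram lam).rowLen}.ncard =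
      numSYT lam * numRegTableaux r lam := by
  have h0 : ∀ k, n ≤ k → (diagram lam).rowLen k = 0 := fun k hk =>
    rowLen_eq_zero_of_card_le _ (by rwa [card_diagram])
  have hdiv : n / r = m := by rw [← hn, Nat.mul_div_cancel _ hr]
  rw [ncard_words_of_shape hn, mul_comm, numSYT, numRegTableaux, hdiv,
    card_tableaux_eq_ncard_chains _ (by rw [card_diagram, mul_one]) h0,
    card_tableaux_eq_ncard_chains _ (by rw [card_diagram, hn]) h0]

end UlamSphere

/-! ### Counting the sphere by shape -/

theorem mainTheorem5 (n r : ℕ) (hn : 0 < n) (hr : 0 < r) (hrn : r ∣ n)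
    (t : ℕ) (ht : t ≤ n - 1) :
    (UlamSphere.ulamSphere r (1 : Equiv.Perm (Fin n)) t).ncard =
      ∑ lam : n.Partition with n - t ≤ (UlamSphere.diagram lam).rowLen 0,
        UlamSphere.numSYT lam * UlamSphere.numRegTableaux r lam := by
  classical
  open UlamSphere in
  obtain ⟨m, hm⟩ := hrn
  rw [mul_comm] at hm
  have hmem := mem_ulamSphere_one_iff hr hm.symm t
  have hfin : (ulamSphere r (1 : Equiv.Perm (Fin n)) t).Finite :=
    (finite_isRegularWord hm.symm).subset fun w hw => ((hmem w).mp hw).1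
  -- The default value is irrelevant: every word of the sphere is regular and has a shape.
  let shape : (Fin n → ℕ) → n.Partition := fun w =>
    if h : ∃ lam : n.Partition, (diagram lam).rowLen = growth (wordMatrix w) n m
    then h.choose else default
  have hshape : ∀ w, IsRegularWord m r w →
      (diagram (shape w)).rowLen = growth (wordMatrix w) n m := fun w hw => by
    have h := exists_diagram_rowLen_eq_growth hm.symm hw
    simp only [shape, dif_pos h]
    exact h.choose_spec
  -- The sphere condition depends only on the first row of the shape, so each admissible fibre
  -- consists of all regular words of that shape.
  rw [Set.ncard_eq_toFinset_card _ hfin, Finset.card_eq_sum_card_fiberwise (f := shape)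
    (t := Finset.univ.filter fun lam => n - t ≤ (diagram lam).rowLen 0)]
  · refine Finset.sum_congr rfl fun lam hlam => ?_
    rw [← ncard_words_of_diagram hr hm.symm lam, ← Set.ncard_coe_finset]
    congr 1
    ext w
    simp only [Finset.coe_filter, Set.Finite.mem_toFinset, Set.mem_ofPred_eq, hmem]
    constructor
    · rintro ⟨⟨hw, -⟩, rfl⟩
      exact ⟨hw, (hshape w hw).symm⟩
    · rintro ⟨hw, hg⟩
      refine ⟨⟨hw, ?_⟩, rowLen_diagram_injective ((hshape w hw).trans hg)⟩
      rw [hg]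
      exact (Finset.mem_filter.mp hlam).2
  · intro w hw
    have hw := (hmem w).mp (hfin.mem_toFinset.mp hw)
    simp only [Finset.coe_filter, Finset.mem_univ, true_and, Set.mem_ofPred_eq]
    rw [hshape w hw.1]
    exact hw.2
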